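/- Let $\Omega$ be the space of functions $\omega:[0,\infty)\to[0,\infty]$ that stay at $0$ from their first hitting time of $0$ on, stay at $\infty$ from their first hitting time $T_\infty(\omega)=\inf\{t:\omega(t)=\infty\}$ of $\infty$ on, and are continuous on $[0,T_\infty(\omega))$. Let $X_t(\omega)=\omega(t)$ be the coordinate process, $\mathcal F_t=\sigma(X_s:s\le t)$, $\mathcal F=\bigvee_{t\ge 0}\mathcal F_t$, and $X_\infty=\sqrt{\limsup_{t\uparrow\infty}X_t\cdot\liminf_{t\uparrow\infty}X_t}$ with $\infty\cdot 0:=1$. For a stopping time $\tau$ (possibly infinite) let $\mathcal F_\tau=\{A\in\mathcal F: A\cap\{\tau\le t\}\in\mathcal F_t\ \forall t\in[0,\infty)\}$, let $X^\tau$ be the stopped process, and put $X_\tau:=X_\infty$ on $\{\tau=\infty\}$. Let $P$ be a probability measure on $(\Omega,\mathcal F)$ under which $X$ is a nonnegative (finite-valued) local martingale with $P(X_0=1)=1$, and let $Q$ be the $h$-transform (Föllmer measure) of $P$, that is, the probability measure on $(\Omega,\mathcal F)$ with $\mathrm dQ|_{\mathcal F_\tau}=X_\tau\,\mathrm dP|_{\mathcal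 F_\tau}$ for all stopping times $\tau$ for which $X^\tau$ is a uniformly integrable $P$-martingale. Then $P(X_\infty=0)=1$ if and only if $Q(X_\infty=\infty)=1$. In that case $P$ and $Q$ are mutually singular, i.e. they are carried by disjoint measurable sets. -/

import Mathlib

open MeasureTheory ProbabilityTheory Filter Topology
open scoped NNReal ENNReal

noncomputable section

namespace PathSpace

/-- The first time `t ∈ [0, ∞)` at which the path `ω` takes the value `a`; it is `∞` if there is
no such finite time. -/
def firstHit (a : ℝ≥0∞) (ω : ℝ≥0 → ℝ≥0∞) : ℝ≥0∞ :=
  ⨅ (t : ℝ≥0) (_ : ω t = a), (t : ℝ≥0∞)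

/-- The path `ω` is absorbed in `a`: it sits in `a` from the first hitting time of `a` on. -/
def AbsorbedIn (a : ℝ≥0∞) (ω : ℝ≥0 → ℝ≥0∞) : Prop :=
  ∀ t : ℝ≥0, firstHit a ω ≤ t → ω t = a

/-- The `[0, ∞]`-valued paths that are absorbed in `0` and in `∞` and that are continuous strictly
before the first hitting time of `∞`. -/
structure IsPath (ω : ℝ≥0 → ℝ≥0∞) : Prop where
  absorbed_zero : AbsorbedIn 0 ω
  absorbed_top : AbsorbedIn ∞ ω
  continuousOn : ContinuousOn ω {t : ℝ≥0 | (t : ℝ≥0∞) < firstHit ∞ ω}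

end PathSpace

/-- The canonical path space `C_abs([0, ∞), [0, ∞])`, with the `σ`-algebra generated by the
coordinates (inherited from the product `σ`-algebra). -/
abbrev PathSpace : Type := {ω : ℝ≥0 → ℝ≥0∞ // PathSpace.IsPath ω}

namespace PathSpace

/-- The coordinate process `X`. -/
def X (t : ℝ≥0) (ω : PathSpace) : ℝ≥0∞ := ω.1 t

lemma measurable_X (t : ℝ≥0) : Measurable (X t) :=
  (measurable_pi_apply t).comp measurable_subtype_coe

/-- The (raw) canonical filtration `ℱ t = σ(X s : s ≤ t)`. -/
def canonicalFiltration : Filtration ℝ≥0 (inferInstance : MeasurableSpace PathSpace) :=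
  Filtration.natural X fun t => (measurable_X t).stronglyMeasurable

open Classical in
/-- `X_∞ = √(limsup X_t · liminf X_t)` as `t ↑ ∞`, with the convention `∞ · 0 = 1`. (As the limes
superior dominates the limes inferior, the convention matters in one case only.) -/
def XInf (ω : PathSpace) : ℝ≥0∞ :=
  if limsup (fun t => X t ω) atTop = ∞ ∧ liminf (fun t => X t ω) atTop = 0 then 1
  else (limsup (fun t => X t ω) atTop * liminf (fun t => X t ω) atTop) ^ (1 / 2 : ℝ)

/-- The value `X_τ` of the coordinate process at the random time `τ`, which is `X_∞` where `τ` is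
not finite. -/
def XAt (τ : PathSpace → WithTop ℝ≥0) (ω : PathSpace) : ℝ≥0∞ :=
  match τ ω with
  | ⊤ => XInf ω
  | (t : ℝ≥0) => X t ω

/-- Under `P`, the coordinate process is a (finite-valued, nonnegative) local martingale with
respect to the canonical filtration, and it starts at `1`. -/
structure IsLocalMartingaleLaw (P : Measure PathSpace) : Prop where
  start_one : ∀ᵐ ω ∂P, X 0 ω = 1
  finite : ∀ᵐ ω ∂P, ∀ t, X t ω ≠ ∞
  locally_martingale :
    Locally (fun Y : ℝ≥0 → PathSpace → ℝ => Martingale Y canonicalFiltration P)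
      canonicalFiltration (fun t ω => (X t ω).toReal) P

/-- The stopped coordinate process `X^τ` is a uniformly integrable martingale under `P`. -/
def IsUIMartingaleStopped (P : Measure PathSpace) (τ : PathSpace → WithTop ℝ≥0) : Prop :=
  Martingale (fun t ω => (stoppedProcess X τ t ω).toReal) canonicalFiltration P ∧
    UniformIntegrable (fun t ω => (stoppedProcess X τ t ω).toReal) 1 P

/-- `Q` is the `h`-transform (Föllmer measure) of `P`: a probability measure on the path space such
that `dQ = X_τ dP` on `ℱ_τ` for every stopping time `τ` for which `X^τ` is a uniformly integrable
martingale under `P`. -/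
structure IsHTransform (P Q : Measure PathSpace) : Prop where
  isProbabilityMeasure : IsProbabilityMeasure Q
  apply_eq : ∀ (τ : PathSpace → WithTop ℝ≥0) (hτ : IsStoppingTime canonicalFiltration τ),
    IsUIMartingaleStopped P τ →
      ∀ A : Set PathSpace, MeasurableSet[hτ.measurableSpace] A → Q A = ∫⁻ ω in A, XAt τ ω ∂P

end PathSpace

end

/-! Let τ_n be the first passage time of level n ≥ 2. Up to τ_n the path stays below n, P-a.s., so X
stopped at τ_n is a uniformly integrable martingale (`isUIMartingaleStopped`) and the change of
measure applies. On {τ_n = ∞} it reads Q(τ_n = ∞) = ∫_{τ_n = ∞} X_∞ dP (`hTransform_hit_eq_top`), so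
Q(τ_n = ∞) = 0 exactly when X_∞ = 0 P-a.s. on {τ_n = ∞}.

On the P side, the maximal inequality P(τ_n < ∞) ≤ 1/n shows that the events {τ_n = ∞} exhaust the
space. On the Q side, X_∞ = ∞ forces every τ_n to be finite. For the converse the liminf must not
vanish, or X_∞ could be 1 by convention: sampling at the entrance into [0, ε] bounds the
Q-probability of reaching that interval by ε, so Q-a.e. path is bounded away from 0.

Singularity follows because X_∞ is 0 under P and ∞ under Q. -/

namespace PathSpace

/-! ### Regularity of paths -/

lemma firstHit_top_le_iff (ω : PathSpace) (t : ℝ≥0) : firstHit ∞ ω.1 ≤ t ↔ X t ω = ∞ :=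
  ⟨ω.2.absorbed_top t, fun h => iInf₂_le t h⟩

lemma lt_firstHit_top_iff (ω : PathSpace) (t : ℝ≥0) :
    (t : ℝ≥0∞) < firstHit ∞ ω.1 ↔ X t ω ≠ ∞ := by
  rw [← not_le, firstHit_top_le_iff]

lemma X_eq_top_of_le {ω : PathSpace} {s t : ℝ≥0} (hst : s ≤ t) (h : X s ω = ∞) : X t ω = ∞ :=
  (firstHit_top_le_iff ω t).1
    (((firstHit_top_le_iff ω s).2 h).trans (ENNReal.coe_le_coe.2 hst))

lemma isOpen_lt_firstHit_top (ω : PathSpace) :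
    IsOpen {t : ℝ≥0 | (t : ℝ≥0∞) < firstHit ∞ ω.1} :=
  isOpen_Iio.preimage ENNReal.continuous_coe

lemma continuousAt_X {ω : PathSpace} {t : ℝ≥0} (h : X t ω ≠ ∞) :
    ContinuousAt (fun s => X s ω) t :=
  ω.2.continuousOn.continuousAt
    ((isOpen_lt_firstHit_top ω).mem_nhds ((lt_firstHit_top_iff ω t).2 h))

lemma continuousWithinAt_X (ω : PathSpace) (t : ℝ≥0) :
    ContinuousWithinAt (fun s => X s ω) (Set.Ici t) t := by
  by_cases h : X t ω = ∞
  · refine (continuousWithinAt_const (b := ∞)).congr (fun s hs => X_eq_top_of_le hs h) h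
  · exact (continuousAt_X h).continuousWithinAt

lemma continuous_X {ω : PathSpace} (h : ∀ t, X t ω ≠ ∞) : Continuous fun s => X s ω :=
  continuous_iff_continuousAt.2 fun t => continuousAt_X (h t)

lemma continuous_X_min {ω : PathSpace} {q : ℝ≥0} (h : X q ω ≠ ∞) :
    Continuous fun s => X (min s q) ω :=
  continuous_iff_continuousAt.2 fun s =>
    ContinuousAt.comp (g := fun r => X r ω) (f := fun r => min r q)
      (continuousAt_X fun h' => h (X_eq_top_of_le (min_le_right s q) h'))
      (continuous_id.min continuous_const).continuousAt

lemma exists_bound_of_ne_top {ω : PathSpace} {q : ℝ≥0} (h : X q ω ≠ ∞) :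
    ∃ n : ℕ, ∀ s ≤ q, X s ω < n := by
  obtain ⟨m, -, hm⟩ := (isCompact_Icc (a := (0 : ℝ≥0)) (b := q)).exists_isMaxOn
    ⟨0, by simp⟩ (continuous_X_min h).continuousOn
  obtain ⟨n, hn⟩ := ENNReal.exists_nat_gt
    (fun h' => h (X_eq_top_of_le (min_le_right m q) h') : X (min m q) ω ≠ ∞)
  refine ⟨n, fun s hs => lt_of_le_of_lt ?_ hn⟩
  have := hm (show s ∈ Set.Icc 0 q from ⟨zero_le, hs⟩)
  simpa [min_eq_left hs] using this

lemma measurable_X_canonical {s t : ℝ≥0} (hst : s ≤ t) :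
    Measurable[canonicalFiltration t] (X s) :=
  ((Filtration.stronglyAdapted_natural
    fun t => (measurable_X t).stronglyMeasurable) s).measurable.mono
      (canonicalFiltration.mono hst) le_rfl

/-! ### Hitting times of closed sets -/

open Classical in
/-- The first time at which the coordinate process enters the set `C`. -/
noncomputable def hit (C : Set ℝ≥0∞) (ω : PathSpace) : WithTop ℝ≥0 :=
  if ∃ t, X t ω ∈ C then ((sInf {t | X t ω ∈ C} : ℝ≥0) : WithTop ℝ≥0) else ⊤

lemma hit_eq_top_iff {C : Set ℝ≥0∞} {ω : PathSpace} : hit C ω = ⊤ ↔ ∀ t, X t ω ∉ C := by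
  unfold hit; split_ifs with h
  · exact iff_of_false WithTop.coe_ne_top fun h' => h.elim h'
  · simpa using h

lemma X_mem_of_hit_eq {C : Set ℝ≥0∞} (hC : IsClosed C) {ω : PathSpace} {t : ℝ≥0}
    (h : hit C ω = t) : X t ω ∈ C := by
  have hne : ∃ t, X t ω ∈ C := by
    by_contra h'
    rw [hit, if_neg h'] at h
    exact WithTop.top_ne_coe h
  rw [hit, if_pos hne, WithTop.coe_inj] at h
  -- The infimum is approached from the right only, so right-continuity suffices, even at an
  -- explosion time.
  have hcl : t ∈ closure {t | X t ω ∈ C} := h ▸ csInf_mem_closure hne (OrderBot.bddBelow _)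
  have hsub : {t | X t ω ∈ C} ⊆ Set.Ici t := fun s hs => h ▸ csInf_le (OrderBot.bddBelow _) hs
  have hc : ContinuousWithinAt (fun s => X s ω) {t | X t ω ∈ C} t :=
    (continuousWithinAt_X ω t).mono hsub
  have := hc.mem_closure_image hcl
  exact hC.closure_subset_iff.2 (by rintro _ ⟨s, hs, rfl⟩; exact hs) this

lemma hit_le_of_mem {C : Set ℝ≥0∞} {ω : PathSpace} {t : ℝ≥0} (h : X t ω ∈ C) : hit C ω ≤ t := by
  rw [hit, if_pos ⟨t, h⟩]
  exact WithTop.coe_le_coe.2 (csInf_le (OrderBot.bddBelow _) h)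

lemma hit_le_iff {C : Set ℝ≥0∞} (hC : IsClosed C) {ω : PathSpace} {t : ℝ≥0} :
    hit C ω ≤ t ↔ ∃ s ≤ t, X s ω ∈ C := by
  refine ⟨fun h => ?_, fun ⟨s, hs, h⟩ => (hit_le_of_mem h).trans (WithTop.coe_le_coe.2 hs)⟩
  obtain ⟨s, hs⟩ := WithTop.ne_top_iff_exists.1 (ne_top_of_le_ne_top WithTop.coe_ne_top h)
  exact ⟨s, WithTop.coe_le_coe.1 (hs ▸ h), X_mem_of_hit_eq hC hs.symm⟩

/-- By compactness of [0, q] the continuous function attains its infimum, which can be computed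
along a dense sequence. An uncountable union thus becomes a measurable event. -/
lemma exists_le_iff_of_ne_top {f : ℝ≥0∞ → ℝ≥0∞} (hf : Continuous f) {ω : PathSpace} {q : ℝ≥0}
    (h : X q ω ≠ ∞) : (∃ s ≤ q, f (X s ω) = 0) ↔
      ⨅ k, f (X (min (TopologicalSpace.denseSeq ℝ≥0 k) q) ω) = 0 := by
  have hc : Continuous fun s => f (X (min s q) ω) := hf.comp (continuous_X_min h)
  constructor
  · rintro ⟨s, hs, h0⟩
    have key : ∀ r, (⨅ k, f (X (min (TopologicalSpace.denseSeq ℝ≥0 k) q) ω)) ≤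
        f (X (min r q) ω) := fun r =>
      (TopologicalSpace.denseRange_denseSeq ℝ≥0).induction_on r
        (isClosed_Ici.preimage hc) fun k => iInf_le _ k
    simpa [min_eq_left hs, h0] using key s
  · intro h0
    obtain ⟨m, hm, hmin⟩ := (isCompact_Icc (a := (0 : ℝ≥0)) (b := q)).exists_isMinOn
      ⟨0, by simp⟩ hc.continuousOn
    refine ⟨m, hm.2, ?_⟩
    rw [← nonpos_iff_eq_zero, ← h0]
    refine le_iInf fun k => ?_
    have := hmin (show min (TopologicalSpace.denseSeq ℝ≥0 k) q ∈ Set.Icc 0 q from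
      ⟨zero_le, min_le_right _ _⟩)
    simpa [min_eq_left hm.2] using this

lemma isStoppingTime_hit {f : ℝ≥0∞ → ℝ≥0∞} (hf : Continuous f) :
    IsStoppingTime canonicalFiltration (hit (f ⁻¹' {0})) := by
  intro t
  -- Three cases: a zero of `f` at the value ∞; no explosion by time t; explosion by time t but a
  -- zero reached earlier at a finite value. In the last case a time of the dense sequence fits
  -- between that zero and the explosion.
  have hset : {ω | hit (f ⁻¹' {0}) ω ≤ t} = {ω | X t ω = ∞ ∧ f ∞ = 0} ∪
      ({ω | X t ω ≠ ∞ ∧ ⨅ k, f (X (min (TopologicalSpace.denseSeq ℝ≥0 k) t) ω) = 0} ∪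
      ⋃ j, {ω | X (min (TopologicalSpace.denseSeq ℝ≥0 j) t) ω ≠ ∞ ∧
        ⨅ k, f (X (min (TopologicalSpace.denseSeq ℝ≥0 k)
          (min (TopologicalSpace.denseSeq ℝ≥0 j) t)) ω) = 0}) := by
    ext ω
    simp only [Set.mem_ofPred_eq, Set.mem_union, Set.mem_iUnion]
    rw [hit_le_iff (isClosed_singleton.preimage hf)]
    simp only [Set.mem_preimage, Set.mem_singleton_iff]
    constructor
    · rintro ⟨s, hs, h0⟩
      by_cases ht : X t ω = ∞
      · by_cases hs' : X s ω = ∞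
        · exact Or.inl ⟨ht, hs' ▸ h0⟩
        · have hst : s < t := lt_of_le_of_ne hs fun h => hs' (h ▸ ht)
          have hev : ∀ᶠ r in 𝓝 s, X r ω ≠ ∞ ∧ r < t :=
            ((continuousAt_X hs').eventually_ne hs').and (eventually_lt_nhds hst)
          have hev' : ∃ᶠ r in 𝓝[>] s, X r ω ≠ ∞ ∧ r < t ∧ s < r :=
            (((hev.filter_mono nhdsWithin_le_nhds).and (self_mem_nhdsWithin : Set.Ioi s ∈ 𝓝[>] s)).mono
              fun r hr => ⟨hr.1.1, hr.1.2, hr.2⟩).frequently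
          obtain ⟨r, hr1, hr2, hr3⟩ := hev'.exists
          obtain ⟨j, hj1, hj2⟩ :=
            (TopologicalSpace.denseRange_denseSeq ℝ≥0).exists_mem_open isOpen_Ioo
              (Set.nonempty_Ioo.2 hr3)
          have hjt : min (TopologicalSpace.denseSeq ℝ≥0 j) t = TopologicalSpace.denseSeq ℝ≥0 j :=
            min_eq_left (hj2.trans hr2).le
          have hjne : X (TopologicalSpace.denseSeq ℝ≥0 j) ω ≠ ∞ := fun h =>
            hr1 (X_eq_top_of_le hj2.le h)
          refine Or.inr (Or.inr ⟨j, ?_⟩)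
          rw [hjt]
          exact ⟨hjne, (exists_le_iff_of_ne_top hf hjne).1 ⟨s, hj1.le, h0⟩⟩
      · exact Or.inr (Or.inl ⟨ht, (exists_le_iff_of_ne_top hf ht).1 ⟨s, hs, h0⟩⟩)
    · rintro (⟨ht, h0⟩ | ⟨ht, h0⟩ | ⟨j, hj, h0⟩)
      · exact ⟨t, le_rfl, ht ▸ h0⟩
      · exact (exists_le_iff_of_ne_top hf ht).2 h0
      · obtain ⟨s, hs, h⟩ := (exists_le_iff_of_ne_top hf hj).2 h0
        exact ⟨s, hs.trans (min_le_right _ _), h⟩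
  rw [hset]
  have hX : ∀ s ≤ t, Measurable[canonicalFiltration t] (X s) := fun s hs =>
    measurable_X_canonical hs
  have hne : ∀ s ≤ t, MeasurableSet[canonicalFiltration t] {ω | X s ω ≠ ∞} := fun s hs =>
    (hX s hs) (measurableSet_singleton ∞).compl
  have hinf : ∀ q ≤ t, MeasurableSet[canonicalFiltration t]
      {ω | ⨅ k, f (X (min (TopologicalSpace.denseSeq ℝ≥0 k) q) ω) = 0} := fun q hq =>
    (Measurable.iInf fun k => hf.measurable.comp (hX _ ((min_le_right _ _).trans hq)))
      (measurableSet_singleton 0)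
  refine MeasurableSet.union ?_ (MeasurableSet.union ?_ (MeasurableSet.iUnion fun j => ?_))
  · exact ((hX t le_rfl) (measurableSet_singleton ∞)).inter (MeasurableSet.const _)
  · exact (hne t le_rfl).inter (hinf t le_rfl)
  · exact (hne _ (min_le_right _ _)).inter (hinf _ (min_le_right _ _))

lemma isStoppingTime_hit_Ici {a : ℝ≥0∞} (ha : a ≠ ∞) :
    IsStoppingTime canonicalFiltration (hit (Set.Ici a)) := by
  have h := isStoppingTime_hit (f := fun x => a - x) (ENNReal.continuous_sub_left ha)
  have hs : (fun x : ℝ≥0∞ => a - x) ⁻¹' {0} = Set.Ici a := by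
    ext x; simp [tsub_eq_zero_iff_le]
  rwa [hs] at h

lemma isStoppingTime_hit_Iic (a : ℝ≥0∞) :
    IsStoppingTime canonicalFiltration (hit (Set.Iic a)) := by
  have h := isStoppingTime_hit (f := fun x => x - a) (ENNReal.continuous_sub_right a)
  have hs : (fun x : ℝ≥0∞ => x - a) ⁻¹' {0} = Set.Iic a := by
    ext x; simp [tsub_eq_zero_iff_le]
  rwa [hs] at h

/-! ### Measurability of X_∞ and its relation to hitting times -/

lemma iSup_X_add (ω : PathSpace) (N : ℝ≥0) :
    ⨆ s, X (N + s) ω = ⨆ k, X (N + TopologicalSpace.denseSeq ℝ≥0 k) ω := by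
  refine le_antisymm (iSup_le fun s => ?_) (iSup_le fun k => le_iSup (fun s => X (N + s) ω) _)
  refine le_of_forall_lt fun c hc => ?_
  have hev : ∀ᶠ r in 𝓝[>] (N + s), c < X r ω :=
    ((continuousWithinAt_X ω (N + s)).mono Set.Ioi_subset_Ici_self).eventually
      (lt_mem_nhds hc)
  obtain ⟨u, hu, hsub⟩ := mem_nhdsGT_iff_exists_Ioo_subset.1 hev
  have hu' : s < u - N := lt_tsub_iff_left.2 hu
  obtain ⟨j, hj1, hj2⟩ := (TopologicalSpace.denseRange_denseSeq ℝ≥0).exists_mem_open isOpen_Ioo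
    (Set.nonempty_Ioo.2 hu')
  have : c < X (N + TopologicalSpace.denseSeq ℝ≥0 j) ω :=
    hsub ⟨add_lt_add_right hj1 N, lt_tsub_iff_left.1 hj2⟩
  exact lt_of_lt_of_le this (le_iSup (fun k => X (N + TopologicalSpace.denseSeq ℝ≥0 k) ω) j)

lemma iInf_X_add (ω : PathSpace) (N : ℝ≥0) :
    ⨅ s, X (N + s) ω = ⨅ k, X (N + TopologicalSpace.denseSeq ℝ≥0 k) ω := by
  refine le_antisymm (le_iInf fun k => iInf_le (fun s => X (N + s) ω) _) (le_iInf fun s => ?_)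
  refine le_of_forall_gt fun c hc => ?_
  have hev : ∀ᶠ r in 𝓝[>] (N + s), X r ω < c :=
    ((continuousWithinAt_X ω (N + s)).mono Set.Ioi_subset_Ici_self).eventually
      (gt_mem_nhds hc)
  obtain ⟨u, hu, hsub⟩ := mem_nhdsGT_iff_exists_Ioo_subset.1 hev
  have hu' : s < u - N := lt_tsub_iff_left.2 hu
  obtain ⟨j, hj1, hj2⟩ := (TopologicalSpace.denseRange_denseSeq ℝ≥0).exists_mem_open isOpen_Ioo
    (Set.nonempty_Ioo.2 hu')
  have : X (N + TopologicalSpace.denseSeq ℝ≥0 j) ω < c :=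
    hsub ⟨add_lt_add_right hj1 N, lt_tsub_iff_left.1 hj2⟩
  exact lt_of_le_of_lt (iInf_le (fun k => X (N + TopologicalSpace.denseSeq ℝ≥0 k) ω) j) this

lemma hasBasis_atTop_nat : (atTop : Filter ℝ≥0).HasBasis (fun _ : ℕ => True)
    fun n => Set.Ici (n : ℝ≥0) :=
  atTop_basis.to_hasBasis (fun a _ => let ⟨n, hn⟩ := exists_nat_ge a
    ⟨n, trivial, Set.Ici_subset_Ici.2 hn⟩) fun n _ => ⟨n, trivial, subset_rfl⟩

lemma iSup_Ici_eq (u : ℝ≥0 → ℝ≥0∞) (N : ℝ≥0) : ⨆ t ∈ Set.Ici N, u t = ⨆ s, u (N + s) :=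
  le_antisymm (iSup₂_le fun t ht => by
    obtain ⟨s, rfl⟩ := exists_add_of_le (Set.mem_Ici.1 ht)
    exact le_iSup (fun s => u (N + s)) s) (iSup_le fun s => le_iSup₂ (f := fun t _ => u t)
      (N + s) (Set.mem_Ici.2 le_self_add))

lemma iInf_Ici_eq (u : ℝ≥0 → ℝ≥0∞) (N : ℝ≥0) : ⨅ t ∈ Set.Ici N, u t = ⨅ s, u (N + s) :=
  le_antisymm (le_iInf fun s => iInf₂_le (f := fun t _ => u t)
      (N + s) (Set.mem_Ici.2 le_self_add)) (le_iInf₂ fun t ht => by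
    obtain ⟨s, rfl⟩ := exists_add_of_le (Set.mem_Ici.1 ht)
    exact iInf_le (fun s => u (N + s)) s)

lemma measurable_limsup_X : Measurable fun ω : PathSpace => limsup (fun t => X t ω) atTop := by
  simp_rw [hasBasis_atTop_nat.limsup_eq_iInf_iSup, iSup_Ici_eq (fun t => X t _), iSup_X_add]
  exact Measurable.iInf fun n => Measurable.iInf fun _ => Measurable.iSup fun k => measurable_X _

lemma measurable_liminf_X : Measurable fun ω : PathSpace => liminf (fun t => X t ω) atTop := by
  simp_rw [hasBasis_atTop_nat.liminf_eq_iSup_iInf, iInf_Ici_eq (fun t => X t _), iInf_X_add]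
  exact Measurable.iSup fun n => Measurable.iSup fun _ => Measurable.iInf fun k => measurable_X _

lemma measurable_XInf : Measurable XInf := by
  unfold XInf
  refine Measurable.ite ?_ measurable_const
    ((measurable_limsup_X.mul measurable_liminf_X).pow_const _)
  exact (measurable_limsup_X (measurableSet_singleton ∞)).inter
    (measurable_liminf_X (measurableSet_singleton 0))

lemma limsup_eq_top_of_XInf {ω : PathSpace} (h : XInf ω = ∞) :
    limsup (fun t => X t ω) atTop = ∞ := by
  unfold XInf at h
  split_ifs at h with h'
  · simp at h
  · rw [ENNReal.rpow_eq_top_iff_of_pos (by norm_num), ENNReal.mul_eq_top] at h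
    rcases h with h | h
    · exact top_le_iff.1 (h.2 ▸ liminf_le_limsup)
    · exact h.1

lemma hit_Ici_ne_top_of_XInf {ω : PathSpace} (h : XInf ω = ∞) (n : ℕ) :
    hit (Set.Ici (n : ℝ≥0∞)) ω ≠ ⊤ := by
  intro h'
  rw [hit_eq_top_iff] at h'
  have : limsup (fun t => X t ω) atTop ≤ n :=
    limsup_le_of_le (by isBoundedDefault) (Eventually.of_forall fun t => (not_le.1 (h' t)).le)
  rw [limsup_eq_top_of_XInf h] at this
  exact ENNReal.natCast_ne_top n (top_le_iff.1 this)

/-- High levels are reached either by explosion or by unboundedness at infinity. If the limsup were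
finite, the path would be bounded after some q and, being finite at q, bounded on [0, q] by
compactness. Avoiding [0, ε] keeps the liminf positive. -/
lemma XInf_eq_top {ω : PathSpace} (hsup : ∀ n : ℕ, hit (Set.Ici ((n + 2 : ℕ) : ℝ≥0∞)) ω ≠ ⊤)
    {ε : ℝ≥0∞} (hε : ε ≠ 0) (hinf : hit (Set.Iic ε) ω = ⊤) : XInf ω = ∞ := by
  have h1 : liminf (fun t => X t ω) atTop ≠ 0 := by
    have : ε ≤ liminf (fun t => X t ω) atTop :=
      le_liminf_of_le (by isBoundedDefault)
        (Eventually.of_forall fun t => (not_le.1 (hit_eq_top_iff.1 hinf t)).le)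
    exact fun h => hε (nonpos_iff_eq_zero.1 (h ▸ this))
  have h2 : limsup (fun t => X t ω) atTop = ∞ := by
    by_contra hne
    obtain ⟨m, hm⟩ := ENNReal.exists_nat_gt hne
    obtain ⟨q, hq⟩ := (eventually_lt_of_limsup_lt hm).exists_forall_of_atTop
    obtain ⟨k, hk⟩ := exists_bound_of_ne_top (hq q le_rfl).ne_top
    refine hsup (m + k) (hit_eq_top_iff.2 fun t => not_le.2 (?_ : X t ω < ((m + k + 2 : ℕ) : ℝ≥0∞)))
    rcases le_total t q with h | h
    · exact (hk t h).trans_le (by gcongr; omega)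
    · exact (hq t h).trans_le (by gcongr; omega)
  rw [XInf, if_neg (fun h => h1 h.2), h2, ENNReal.top_mul h1]
  simp

end PathSpace
-- Optional sampling in continuous time by discretisation from above
/-- The approximation of `x` from above by the grid of mesh `1 / (k + 1)`, truncated at `T`. -/
noncomputable def gridCeil (T : ℝ≥0) (k : ℕ) (x : ℝ≥0) : ℝ≥0 :=
  min T ((⌈x * (k + 1)⌉₊ : ℝ≥0) / (k + 1))

lemma gridCeil_le (T : ℝ≥0) (k : ℕ) (x : ℝ≥0) : gridCeil T k x ≤ T := min_le_left _ _

lemma le_gridCeil {T : ℝ≥0} (k : ℕ) {x : ℝ≥0} (hx : x ≤ T) : x ≤ gridCeil T k x := by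
  refine le_min hx ?_
  rw [le_div_iff₀ (by positivity)]
  exact Nat.le_ceil _

lemma gridCeil_le_add (T : ℝ≥0) (k : ℕ) (x : ℝ≥0) : gridCeil T k x ≤ x + 1 / (k + 1) := by
  refine (min_le_right _ _).trans ?_
  rw [div_le_iff₀ (by positivity), add_mul, one_div, inv_mul_cancel₀ (by positivity)]
  exact (Nat.ceil_lt_add_one zero_le).le

lemma tendsto_gridCeil {T x : ℝ≥0} (hx : x ≤ T) :
    Tendsto (fun k => gridCeil T k x) atTop (𝓝[≥] x) := by
  refine tendsto_nhdsWithin_iff.2 ⟨?_, Eventually.of_forall fun k => le_gridCeil k hx⟩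
  refine tendsto_of_tendsto_of_tendsto_of_le_of_le tendsto_const_nhds ?_
    (fun k => le_gridCeil k hx) (fun k => gridCeil_le_add T k x)
  simpa using tendsto_const_nhds.add (tendsto_one_div_add_atTop_nhds_zero_nat (𝕜 := ℝ≥0))

lemma measurable_gridCeil (T : ℝ≥0) (k : ℕ) : Measurable (gridCeil T k) := by
  unfold gridCeil
  fun_prop

lemma countable_range_gridCeil (T : ℝ≥0) (k : ℕ) : (Set.range (gridCeil T k)).Countable := by
  refine (Set.countable_range fun n : ℕ => min T ((n : ℝ≥0) / (k + 1))).mono ?_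
  rintro _ ⟨x, rfl⟩
  exact ⟨⌈x * (k + 1)⌉₊, rfl⟩

lemma WithTop.coe_untopA_min_coe (u : ℝ≥0) (x : WithTop ℝ≥0) :
    (((min (u : WithTop ℝ≥0) x).untopA : ℝ≥0) : WithTop ℝ≥0) = min (u : WithTop ℝ≥0) x := by
  cases x with
  | top => rw [min_eq_left le_top]; rfl
  | coe a => rw [← WithTop.coe_min]; rfl

section

variable {Ω : Type*} {m : MeasurableSpace Ω} {ℱ : Filtration ℝ≥0 m} {s : Ω → ℝ≥0}

lemma MeasureTheory.IsStoppingTime.measurable_coe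
    (hs : IsStoppingTime ℱ fun ω => (s ω : WithTop ℝ≥0)) :
    Measurable[hs.measurableSpace] s := by
  let _ := hs.measurableSpace
  refine measurable_of_Iic fun i => ?_
  have := hs.measurableSet_le' i
  simp only [WithTop.coe_le_coe] at this
  exact this

/-- Rounding up makes {`gridCeil T k s` ≤ i} an event of the σ-algebra at `s` contained in {s ≤ i}.
-/
lemma MeasureTheory.IsStoppingTime.gridCeil_comp {T : ℝ≥0} (k : ℕ)
    (hs : IsStoppingTime ℱ fun ω => (s ω : WithTop ℝ≥0)) (hsT : ∀ ω, s ω ≤ T) :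
    IsStoppingTime ℱ fun ω => (gridCeil T k (s ω) : WithTop ℝ≥0) := by
  intro i
  have h1 : MeasurableSet[hs.measurableSpace] {ω | gridCeil T k (s ω) ≤ i} :=
    ((measurable_gridCeil T k).comp hs.measurable_coe) measurableSet_Iic
  have h2 := ((hs.measurableSet _).1 h1).2 i
  convert h2 using 1
  ext ω
  simp only [Set.mem_ofPred_eq, Set.mem_inter_iff, WithTop.coe_le_coe]
  exact ⟨fun h => ⟨h, (le_gridCeil k (hsT ω)).trans h⟩, fun h => h.1⟩

/-- The value of a right-continuous adapted process at a bounded stopping time. -/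
lemma MeasureTheory.IsStoppingTime.measurable_process {β : Type*} [TopologicalSpace β]
    [TopologicalSpace.PseudoMetrizableSpace β] [MeasurableSpace β] [BorelSpace β]
    {Y : ℝ≥0 → Ω → β} (hs : IsStoppingTime ℱ fun ω => (s ω : WithTop ℝ≥0)) {T : ℝ≥0}
    (hsT : ∀ ω, s ω ≤ T) (hY : ∀ t, Measurable[ℱ t] (Y t))
    (hc : ∀ ω t, ContinuousWithinAt (fun r => Y r ω) (Set.Ici t) t) :
    Measurable[ℱ T] fun ω => Y (s ω) ω := by
  have hsm : Measurable[ℱ T] s :=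
    hs.measurable_coe.mono (hs.measurableSpace_le_of_le_const
      fun ω => WithTop.coe_le_coe.2 (hsT ω)) le_rfl
  refine @measurable_of_tendsto_metrizable _ _ (ℱ T) _ _ _ _
    (fun k ω => Y (gridCeil T k (s ω)) ω) _ (fun k => ?_) ?_
  · intro B hB
    have : (fun ω => Y (gridCeil T k (s ω)) ω) ⁻¹' B =
        ⋃ r ∈ Set.range (gridCeil T k), {ω | gridCeil T k (s ω) = r} ∩ Y r ⁻¹' B := by
      ext ω
      simp only [Set.mem_preimage, Set.mem_iUnion, Set.mem_inter_iff, Set.mem_ofPred_eq]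
      exact ⟨fun h => ⟨_, ⟨_, rfl⟩, rfl, h⟩, fun ⟨r, _, hr, h⟩ => hr ▸ h⟩
    rw [this]
    refine MeasurableSet.biUnion (countable_range_gridCeil T k) fun r hr => ?_
    obtain ⟨x, rfl⟩ := hr
    exact (((measurable_gridCeil T k).comp hsm) (measurableSet_singleton _)).inter
      (ℱ.mono (gridCeil_le T k x) _ (hY _ hB))
  · rw [tendsto_pi_nhds]
    exact fun ω => (hc ω (s ω)).tendsto.comp (tendsto_gridCeil (hsT ω))

/-- Optional sampling for right-continuous martingales and bounded stopping times. -/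
theorem MeasureTheory.Martingale.setIntegral_stopping_time {μ : Measure Ω} [IsFiniteMeasure μ]
    {M : ℝ≥0 → Ω → ℝ} (hM : Martingale M ℱ μ)
    (hc : ∀ᵐ ω ∂μ, ∀ t, ContinuousWithinAt (fun r => M r ω) (Set.Ici t) t) {T : ℝ≥0}
    (hs : IsStoppingTime ℱ fun ω => (s ω : WithTop ℝ≥0)) (hsT : ∀ ω, s ω ≤ T) :
    Integrable (fun ω => M (s ω) ω) μ ∧ ∀ A, MeasurableSet[hs.measurableSpace] A →
      ∫ ω in A, M (s ω) ω ∂μ = ∫ ω in A, M T ω ∂μ := by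
  have hk : ∀ k, IsStoppingTime ℱ fun ω => (gridCeil T k (s ω) : WithTop ℝ≥0) :=
    fun k => hs.gridCeil_comp k hsT
  have hle : ∀ k, (hk k).measurableSpace ≤ m := fun k => (hk k).measurableSpace_le
  have heq : ∀ k, (fun ω => M (gridCeil T k (s ω)) ω) =ᵐ[μ] μ[M T | (hk k).measurableSpace] := by
    intro k
    have hr : (Set.range fun ω => (gridCeil T k (s ω) : WithTop ℝ≥0)).Countable := by
      refine ((countable_range_gridCeil T k).image ((↑) : ℝ≥0 → WithTop ℝ≥0)).mono ?_
      rintro _ ⟨ω, rfl⟩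
      exact ⟨_, ⟨s ω, rfl⟩, rfl⟩
    exact hM.stoppedValue_ae_eq_condExp_of_le_const_of_countable_range (hk k)
      (fun ω => WithTop.coe_le_coe.2 (gridCeil_le T k (s ω))) hr
  -- Conditional expectations of the single variable M_T are uniformly integrable, which upgrades
  -- the pointwise limit to an L¹ limit.
  have hUI : UniformIntegrable (fun k ω => M (gridCeil T k (s ω)) ω) 1 μ :=
    ((hM.integrable T).uniformIntegrable_condExp hle).ae_eq fun k => (heq k).symm
  have hlim : ∀ᵐ ω ∂μ, Tendsto (fun k => M (gridCeil T k (s ω)) ω) atTop (𝓝 (M (s ω) ω)) := by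
    filter_upwards [hc] with ω hω
    exact (hω (s ω)).tendsto.comp (tendsto_gridCeil (hsT ω))
  have hint : Integrable (fun ω => M (s ω) ω) μ := hUI.integrable_of_ae_tendsto hlim
  refine ⟨hint, fun A hA => ?_⟩
  have hL1 := tendsto_Lp_finite_of_tendsto_ae le_rfl ENNReal.one_ne_top hUI.1
    (memLp_one_iff_integrable.2 hint) hUI.2.1 hlim
  have hconv := tendsto_setIntegral_of_L1' _ hint.1
    (Eventually.of_forall fun k => memLp_one_iff_integrable.1 (hUI.memLp k)) hL1 A
  refine tendsto_nhds_unique hconv (tendsto_const_nhds.congr fun k => ?_)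
  have hAk : MeasurableSet[(hk k).measurableSpace] A :=
    hs.measurableSpace_mono (hk k) (fun ω => WithTop.coe_le_coe.2 (le_gridCeil k (hsT ω))) _ hA
  rw [← setIntegral_condExp (hle k) (hM.integrable T) hAk]
  exact integral_congr_ae (ae_restrict_of_ae (heq k).symm)

/-- The stopped process of a right-continuous martingale has the martingale property. -/
theorem MeasureTheory.Martingale.setIntegral_min_stopping_time {μ : Measure Ω}
    [IsFiniteMeasure μ] {M : ℝ≥0 → Ω → ℝ} (hM : Martingale M ℱ μ)
    (hc : ∀ᵐ ω ∂μ, ∀ t, ContinuousWithinAt (fun r => M r ω) (Set.Ici t) t)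
    {τ : Ω → WithTop ℝ≥0} (hτ : IsStoppingTime ℱ τ) {r t : ℝ≥0} (hrt : r ≤ t) {A : Set Ω}
    (hA : MeasurableSet[ℱ r] A) :
    Integrable (stoppedProcess M τ r) μ ∧ Integrable (stoppedProcess M τ t) μ ∧
      ∫ ω in A, stoppedProcess M τ r ω ∂μ = ∫ ω in A, stoppedProcess M τ t ω ∂μ := by
  have hcoe := fun (u : ℝ≥0) ω => WithTop.coe_untopA_min_coe u (τ ω)
  have hst : ∀ u : ℝ≥0, IsStoppingTime ℱ fun ω =>
      (((min (u : WithTop ℝ≥0) (τ ω)).untopA : ℝ≥0) : WithTop ℝ≥0) := fun u => by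
    simp_rw [hcoe]
    exact (isStoppingTime_const ℱ u).min hτ
  have hbd : ∀ (u : ℝ≥0) ω, (min (u : WithTop ℝ≥0) (τ ω)).untopA ≤ u := fun u ω => by
    rw [← WithTop.coe_le_coe, hcoe]; exact min_le_left _ _
  obtain ⟨hi1, he1⟩ := hM.setIntegral_stopping_time hc (hst r) fun ω => (hbd r ω).trans hrt
  obtain ⟨hi2, he2⟩ := hM.setIntegral_stopping_time hc (hst t) (hbd t)
  -- On {r ≤ τ} the event belongs to the σ-algebra at r ∧ τ, so both integrals equal that of M_t.
  -- Off it τ < r, and the two stopped values coincide.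
  have hB : MeasurableSet[(hst r).measurableSpace] (A ∩ {ω | (r : WithTop ℝ≥0) ≤ τ ω}) := by
    have := (isStoppingTime_const ℱ r).measurableSet_inter_le hτ A
      (by rwa [IsStoppingTime.measurableSpace_const])
    simpa only [IsStoppingTime.measurableSet, hcoe] using this
  have hB' : MeasurableSet[(hst t).measurableSpace] (A ∩ {ω | (r : WithTop ℝ≥0) ≤ τ ω}) := by
    refine (hst r).measurableSpace_mono (hst t) (fun ω => ?_) _ hB
    simp only [hcoe]
    exact min_le_min_right _ (WithTop.coe_le_coe.2 hrt)
  have hD : MeasurableSet {ω | (r : WithTop ℝ≥0) ≤ τ ω} :=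
    ℱ.le r _ (hτ.measurableSet_ge r)
  refine ⟨hi1, hi2, ?_⟩
  change ∫ ω in A, M (min (r : WithTop ℝ≥0) (τ ω)).untopA ω ∂μ =
    ∫ ω in A, M (min (t : WithTop ℝ≥0) (τ ω)).untopA ω ∂μ
  rw [← integral_inter_add_sdiff hD hi1.integrableOn, ← integral_inter_add_sdiff hD hi2.integrableOn]
  congr 1
  · exact (he1 _ hB).trans (he2 _ hB').symm
  · refine setIntegral_congr_fun ((ℱ.le r _ hA).diff hD) fun ω hω => ?_
    have h : τ ω ≤ r := (not_le.1 hω.2).le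
    simp only [min_eq_right h, min_eq_right (h.trans (WithTop.coe_le_coe.2 hrt))]

end
-- Stopping the local martingale below a level
namespace PathSpace

lemma continuous_untopA_min (x : WithTop ℝ≥0) :
    Continuous fun t : ℝ≥0 => (min (t : WithTop ℝ≥0) x).untopA := by
  cases x with
  | top =>
    have : (fun t : ℝ≥0 => (min (t : WithTop ℝ≥0) ⊤).untopA) = fun t => t := by
      ext1 t; rw [min_eq_left le_top]; rfl
    rw [this]
    exact continuous_id
  | coe a =>
    have : (fun t : ℝ≥0 => (min (t : WithTop ℝ≥0) (a : WithTop ℝ≥0)).untopA) =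
        fun t => min t a := by
      ext1 t; rw [← WithTop.coe_min]; rfl
    rw [this]
    exact continuous_id.min continuous_const

/-- Before the first passage of level `a`, a finite path that starts below `a` is bounded by `a`. -/
lemma X_le_of_le_hit {ω : PathSpace} {a : ℝ≥0∞} (h0 : X 0 ω < a) (hfin : ∀ t, X t ω ≠ ∞)
    {u : ℝ≥0} (hu : (u : WithTop ℝ≥0) ≤ hit (Set.Ici a) ω) : X u ω ≤ a := by
  have hlt : ∀ r : ℝ≥0, (r : WithTop ℝ≥0) < hit (Set.Ici a) ω → X r ω < a := fun r hr =>
    not_le.1 fun h => (hit_le_of_mem (C := Set.Ici a) h).not_gt hr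
  rcases eq_or_ne u 0 with rfl | hu0
  · exact h0.le
  have : (𝓝[<] u).NeBot := nhdsLT_neBot_of_exists_lt ⟨0, pos_iff_ne_zero.2 hu0⟩
  refine le_of_tendsto ((continuous_X hfin).continuousWithinAt (s := Set.Iio u)).tendsto ?_
  filter_upwards [self_mem_nhdsWithin] with r hr
  exact (hlt r ((WithTop.coe_lt_coe.2 hr).trans_le hu)).le

variable {P : Measure PathSpace} {τ : PathSpace → WithTop ℝ≥0}

lemma measurable_stoppedProcess (hτ : IsStoppingTime canonicalFiltration τ) (t : ℝ≥0) :
    Measurable[canonicalFiltration t] (stoppedProcess X τ t) := by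
  have hs : IsStoppingTime canonicalFiltration fun ω =>
      (((min (t : WithTop ℝ≥0) (τ ω)).untopA : ℝ≥0) : WithTop ℝ≥0) := by
    simp_rw [WithTop.coe_untopA_min_coe]
    exact (isStoppingTime_const _ t).min hτ
  refine hs.measurable_process (Y := X) (T := t) (fun ω => ?_)
    (fun t => measurable_X_canonical le_rfl) continuousWithinAt_X
  rw [← WithTop.coe_le_coe, WithTop.coe_untopA_min_coe]
  exact min_le_left _ _

/-- The start at 1 < n and continuity bound the stopped process by n. The martingale identity holds
for each localised process and passes to the limit by dominated convergence. -/
theorem isUIMartingaleStopped [IsProbabilityMeasure P] (hP : IsLocalMartingaleLaw P)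
    (hτ : IsStoppingTime canonicalFiltration τ) {n : ℕ} (hn : 1 < n)
    (hle : ∀ ω, τ ω ≤ hit (Set.Ici (n : ℝ≥0∞)) ω) : IsUIMartingaleStopped P τ := by
  have hX : ∀ᵐ ω ∂P, ∀ u : ℝ≥0, (u : WithTop ℝ≥0) ≤ τ ω → (X u ω).toReal ≤ n := by
    filter_upwards [hP.start_one, hP.finite] with ω h1 hfin u hu
    refine ENNReal.toReal_le_of_le_ofReal (by positivity) ?_
    rw [ENNReal.ofReal_natCast]
    exact X_le_of_le_hit (by rw [h1]; exact_mod_cast hn) hfin (hu.trans (hle ω))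
  have hbd : ∀ t, ∀ᵐ ω ∂P, (stoppedProcess X τ t ω).toReal ≤ n := fun t => by
    filter_upwards [hX] with ω hω
    exact hω _ ((WithTop.coe_untopA_min_coe t (τ ω)).trans_le (min_le_right _ _))
  have hmeas : ∀ t, StronglyMeasurable[canonicalFiltration t]
      fun ω => (stoppedProcess X τ t ω).toReal := fun t =>
    (measurable_stoppedProcess hτ t).ennreal_toReal.stronglyMeasurable
  have hmeas' : ∀ t, AEStronglyMeasurable (fun ω => (stoppedProcess X τ t ω).toReal) P :=
    fun t => ((hmeas t).mono (canonicalFiltration.le t)).aestronglyMeasurable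
  have hint : ∀ t, Integrable (fun ω => (stoppedProcess X τ t ω).toReal) P := fun t =>
    Integrable.of_bound (hmeas' t) n <| by
      filter_upwards [hbd t] with ω hω
      rwa [Real.norm_of_nonneg ENNReal.toReal_nonneg]
  refine ⟨⟨hmeas, fun r t hrt => ?_⟩, ?_⟩
  · refine (ae_eq_condExp_of_forall_setIntegral_eq (canonicalFiltration.le r) (hint t)
      (fun A _ _ => (hint r).integrableOn) (fun A hA _ => ?_)
      (hmeas r).aestronglyMeasurable).symm
    obtain ⟨σ, hσ, hM⟩ := hP.locally_martingale
    set M := fun k => stoppedProcess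
      (fun i => {ω | ⊥ < σ k ω}.indicator fun ω => (X i ω).toReal) (σ k)
    have hMc : ∀ k, ∀ᵐ ω ∂P, ∀ t, ContinuousWithinAt (fun u => M k u ω) (Set.Ici t) t := fun k => by
      filter_upwards [hP.finite] with ω hfin t
      have hc : Continuous fun u : ℝ≥0 => (X (min (u : WithTop ℝ≥0) (σ k ω)).untopA ω).toReal :=
        continuous_iff_continuousAt.2 fun u => (ENNReal.tendsto_toReal (hfin _)).comp
          (((continuous_X hfin).comp (continuous_untopA_min (σ k ω))).tendsto u)
      simp only [M, stoppedProcess, Set.indicator_apply]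
      split_ifs
      · exact hc.continuousWithinAt
      · exact continuousWithinAt_const
    have key := fun k => (hM k).setIntegral_min_stopping_time (hMc k) hτ hrt hA
    have hlim : ∀ u : ℝ≥0, (∀ k, Integrable (stoppedProcess (M k) τ u) P) →
        Tendsto (fun k => ∫ ω in A, stoppedProcess (M k) τ u ω ∂P) atTop
          (𝓝 (∫ ω in A, (stoppedProcess X τ u ω).toReal ∂P)) := by
      intro u hi
      refine tendsto_integral_of_dominated_convergence (fun _ => (n : ℝ))
        (fun k => (hi k).1.restrict) (integrable_const _) (fun k => ae_restrict_of_ae ?_)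
        (ae_restrict_of_ae ?_)
      · filter_upwards [hX] with ω hω
        simp only [M, stoppedProcess, Set.indicator_apply]
        split_ifs
        · rw [Real.norm_of_nonneg ENNReal.toReal_nonneg]
          refine hω _ ?_
          rw [WithTop.coe_untopA_min_coe, WithTop.coe_untopA_min_coe]
          exact (min_le_left _ _).trans (min_le_right _ _)
        · simp
      · filter_upwards [hσ.tendsto_top] with ω hω
        refine tendsto_const_nhds.congr' ?_
        filter_upwards [hω.eventually (lt_mem_nhds (WithTop.coe_lt_top u))] with k hk
        have hpos : ⊥ < σ k ω := bot_le.trans_lt hk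
        have hmin : min (((min (u : WithTop ℝ≥0) (τ ω)).untopA : ℝ≥0) : WithTop ℝ≥0) (σ k ω) =
            min (u : WithTop ℝ≥0) (τ ω) := by
          rw [WithTop.coe_untopA_min_coe]
          exact min_eq_left ((min_le_left _ _).trans hk.le)
        simp only [M, stoppedProcess, hmin]
        rw [Set.indicator_of_mem (show ω ∈ {ω | ⊥ < σ k ω} from hpos)]
    exact tendsto_nhds_unique (hlim r fun k => (key k).1)
      ((hlim t fun k => (key k).2.1).congr fun k => (key k).2.2.symm)
  -- Any threshold above the bound n makes the truncated tail vanish a.s.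
  · refine uniformIntegrable_of le_rfl ENNReal.one_ne_top hmeas' fun ε _ => ⟨n + 1, fun t => ?_⟩
    have : {ω | (n + 1 : ℝ≥0) ≤ ‖(stoppedProcess X τ t ω).toReal‖₊}.indicator
        (fun ω => (stoppedProcess X τ t ω).toReal) =ᵐ[P] 0 := by
      filter_upwards [hbd t] with ω hω
      refine Set.indicator_of_notMem (fun h => ?_) _
      have h' : ((n : ℝ) + 1) ≤ ‖(stoppedProcess X τ t ω).toReal‖ := by exact_mod_cast h
      rw [Real.norm_of_nonneg ENNReal.toReal_nonneg] at h'
      linarith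
    rw [eLpNorm_congr_ae this]
    simp

/-! ### Consequences of the change of measure -/

lemma XAt_of_eq_top {ω : PathSpace} (h : τ ω = ⊤) : XAt τ ω = XInf ω := by
  simp [XAt, h]

lemma XAt_of_eq_coe {ω : PathSpace} {t : ℝ≥0} (h : τ ω = t) : XAt τ ω = X t ω := by
  simp [XAt, h]

section HTransform

variable {Q : Measure PathSpace} [IsProbabilityMeasure P]

lemma hTransform_hit_eq_top (hP : IsLocalMartingaleLaw P) (hQ : IsHTransform P Q) {n : ℕ}
    (hn : 1 < n) : Q {ω | hit (Set.Ici (n : ℝ≥0∞)) ω = ⊤} =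
      ∫⁻ ω in {ω | hit (Set.Ici (n : ℝ≥0∞)) ω = ⊤}, XInf ω ∂P := by
  have hτ := isStoppingTime_hit_Ici (ENNReal.natCast_ne_top n)
  rw [hQ.apply_eq _ hτ (isUIMartingaleStopped hP hτ hn fun _ => le_rfl) _
    (show MeasurableSet[hτ.measurableSpace] {ω | hit (Set.Ici (n : ℝ≥0∞)) ω = ⊤} from
      hτ.measurable (measurableSet_singleton ⊤))]
  exact setLIntegral_congr_fun hτ.measurableSet_eq_top fun ω hω => XAt_of_eq_top hω

/-- The maximal inequality for the nonnegative local martingale `X`. -/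
lemma mul_measure_hit_ne_top_le (hP : IsLocalMartingaleLaw P) (hQ : IsHTransform P Q) {n : ℕ}
    (hn : 1 < n) : n * P {ω | hit (Set.Ici (n : ℝ≥0∞)) ω ≠ ⊤} ≤ 1 := by
  have := hQ.isProbabilityMeasure
  have hτ := isStoppingTime_hit_Ici (ENNReal.natCast_ne_top n)
  have hA : MeasurableSet[hτ.measurableSpace] {ω | hit (Set.Ici (n : ℝ≥0∞)) ω ≠ ⊤} :=
    hτ.measurable (measurableSet_singleton ⊤).compl
  calc n * P {ω | hit (Set.Ici (n : ℝ≥0∞)) ω ≠ ⊤}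
      = ∫⁻ _ in {ω | hit (Set.Ici (n : ℝ≥0∞)) ω ≠ ⊤}, n ∂P := by simp
    _ ≤ ∫⁻ ω in {ω | hit (Set.Ici (n : ℝ≥0∞)) ω ≠ ⊤}, XAt (hit (Set.Ici (n : ℝ≥0∞))) ω ∂P := by
        refine setLIntegral_mono' (hτ.measurableSpace_le _ hA) fun ω hω => ?_
        obtain ⟨t, ht⟩ := WithTop.ne_top_iff_exists.1 hω
        rw [XAt_of_eq_coe ht.symm]
        exact X_mem_of_hit_eq isClosed_Ici ht.symm
    _ = Q {ω | hit (Set.Ici (n : ℝ≥0∞)) ω ≠ ⊤} :=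
        (hQ.apply_eq _ hτ (isUIMartingaleStopped hP hτ hn fun _ => le_rfl) _ hA).symm
    _ ≤ 1 := prob_le_one

/-- The change of measure is used at the minimum of the two times, where the stopped process is
bounded; on this event the sampled value is at most ε. -/
lemma hTransform_hit_lt_hit_le (hP : IsLocalMartingaleLaw P) (hQ : IsHTransform P Q) {n : ℕ}
    (hn : 1 < n) (ε : ℝ≥0∞) :
    Q {ω | hit (Set.Iic ε) ω < hit (Set.Ici (n : ℝ≥0∞)) ω} ≤ ε := by
  have hσ := isStoppingTime_hit_Ici (ENNReal.natCast_ne_top n)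
  have hρ := isStoppingTime_hit_Iic ε
  have hA : MeasurableSet[(hσ.min hρ).measurableSpace]
      {ω | hit (Set.Iic ε) ω < hit (Set.Ici (n : ℝ≥0∞)) ω} := by
    have := (hσ.measurableSet_stopping_time_le_min hρ).compl
    simpa only [Set.compl_def, Set.mem_ofPred_eq, not_le] using this
  rw [hQ.apply_eq _ (hσ.min hρ)
    (isUIMartingaleStopped hP (hσ.min hρ) hn fun _ => min_le_left _ _) _ hA]
  calc _ ≤ ∫⁻ _ in {ω | hit (Set.Iic ε) ω < hit (Set.Ici (n : ℝ≥0∞)) ω}, ε ∂P := by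
        refine setLIntegral_mono' ((hσ.min hρ).measurableSpace_le _ hA) fun ω hω => ?_
        obtain ⟨t, ht⟩ := WithTop.ne_top_iff_exists.1 (lt_top_of_lt (Set.mem_ofPred_eq ▸ hω)).ne
        rw [XAt_of_eq_coe (t := t) (by rw [ht]; exact min_eq_right (le_of_lt hω))]
        exact X_mem_of_hit_eq isClosed_Iic ht.symm
    _ ≤ ε := by
        rw [setLIntegral_const]
        exact mul_le_of_le_one_right' prob_le_one

/-- A path entering [0, ε] is bounded up to that time, so it enters before reaching some high level.
The bound ε is uniform in the level and survives the increasing union. -/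
lemma hTransform_hit_Iic_ne_top_le (hP : IsLocalMartingaleLaw P) (hQ : IsHTransform P Q)
    {ε : ℝ≥0∞} (hε : ε ≠ ∞) : Q {ω | hit (Set.Iic ε) ω ≠ ⊤} ≤ ε := by
  have hsub : {ω | hit (Set.Iic ε) ω ≠ ⊤} ⊆
      ⋃ n : ℕ, {ω | hit (Set.Iic ε) ω < hit (Set.Ici ((n + 2 : ℕ) : ℝ≥0∞)) ω} := by
    intro ω hω
    obtain ⟨t, ht⟩ := WithTop.ne_top_iff_exists.1 hω
    have hX : X t ω ≤ ε := X_mem_of_hit_eq isClosed_Iic ht.symm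
    obtain ⟨k, hk⟩ := exists_bound_of_ne_top (ne_top_of_le_ne_top hε hX)
    refine Set.mem_iUnion.2 ⟨k, ?_⟩
    rw [Set.mem_ofPred_eq, ← ht, ← not_le, hit_le_iff isClosed_Ici]
    rintro ⟨s, hs, h⟩
    refine (hk s hs).not_ge (le_trans ?_ (Set.mem_Ici.1 h))
    gcongr; omega
  have hmono : Monotone fun n : ℕ =>
      {ω | hit (Set.Iic ε) ω < hit (Set.Ici ((n + 2 : ℕ) : ℝ≥0∞)) ω} := by
    intro a b hab ω hω
    refine lt_of_lt_of_le (Set.mem_ofPred_eq ▸ hω) (le_of_forall_ge fun c hc => ?_)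
    cases c with
    | top => exact le_top
    | coe c =>
      obtain ⟨s, hs, h⟩ := (hit_le_iff isClosed_Ici).1 hc
      refine (hit_le_iff isClosed_Ici).2 ⟨s, hs, le_trans ?_ (Set.mem_Ici.1 h)⟩
      gcongr
  refine (measure_mono hsub).trans ?_
  rw [hmono.measure_iUnion]
  exact iSup_le fun n => hTransform_hit_lt_hit_le hP hQ (by omega) ε

/-- Under the `h`-transform, the paths are bounded away from `0`. -/
lemma hTransform_ae_exists_hit_Iic_eq_top (hP : IsLocalMartingaleLaw P)
    (hQ : IsHTransform P Q) :
    ∀ᵐ ω ∂Q, ∃ k : ℕ, hit (Set.Iic ((k : ℝ≥0∞) + 1)⁻¹) ω = ⊤ := by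
  rw [ae_iff, ← nonpos_iff_eq_zero]
  have hlim : Tendsto (fun k : ℕ => ((k : ℝ≥0∞) + 1)⁻¹) atTop (𝓝 0) := by
    have := ENNReal.tendsto_inv_nat_nhds_zero.comp (tendsto_add_atTop_nat 1)
    simpa [Function.comp_def] using this
  refine ge_of_tendsto' hlim fun k => ?_
  refine (measure_mono fun ω hω => ?_).trans
    (hTransform_hit_Iic_ne_top_le hP hQ (ε := ((k : ℝ≥0∞) + 1)⁻¹) (by simp))
  exact fun h => hω ⟨k, h⟩

lemma hTransform_ae_XInf_eq_top (hP : IsLocalMartingaleLaw P) (hQ : IsHTransform P Q)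
    (h : ∀ᵐ ω ∂P, XInf ω = 0) : ∀ᵐ ω ∂Q, XInf ω = ∞ := by
  -- The shift by 2 puts every level strictly above the starting value 1.
  have h1 : ∀ᵐ ω ∂Q, ∀ n : ℕ, hit (Set.Ici ((n + 2 : ℕ) : ℝ≥0∞)) ω ≠ ⊤ := by
    refine ae_all_iff.2 fun n => ?_
    rw [ae_iff]
    simp only [ne_eq, not_not]
    rw [hTransform_hit_eq_top hP hQ (by omega),
      lintegral_congr_ae (ae_restrict_of_ae h), lintegral_zero]
  filter_upwards [h1, hTransform_ae_exists_hit_Iic_eq_top hP hQ] with ω hω ⟨k, hk⟩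
  exact XInf_eq_top hω (by simp) hk

lemma ae_XInf_eq_zero_of_hTransform (hP : IsLocalMartingaleLaw P) (hQ : IsHTransform P Q)
    (h : ∀ᵐ ω ∂Q, XInf ω = ∞) : ∀ᵐ ω ∂P, XInf ω = 0 := by
  have h1 : ∀ᵐ ω ∂P, ∀ n : ℕ, hit (Set.Ici ((n + 2 : ℕ) : ℝ≥0∞)) ω = ⊤ → XInf ω = 0 := by
    refine ae_all_iff.2 fun n => ?_
    have hz : Q {ω | hit (Set.Ici ((n + 2 : ℕ) : ℝ≥0∞)) ω = ⊤} = 0 :=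
      measure_mono_null (fun ω hω hω' => hit_Ici_ne_top_of_XInf hω' (n + 2) hω) h
    rw [hTransform_hit_eq_top hP hQ (by omega), lintegral_eq_zero_iff measurable_XInf] at hz
    exact (ae_restrict_iff'
      (isStoppingTime_hit_Ici (ENNReal.natCast_ne_top _)).measurableSet_eq_top).1 hz
  -- By the maximal inequality the exceptional set has P-measure at most 1/(n + 2) for every n.
  have h2 : ∀ᵐ ω ∂P, ∃ n : ℕ, hit (Set.Ici ((n + 2 : ℕ) : ℝ≥0∞)) ω = ⊤ := by
    rw [ae_iff, ← nonpos_iff_eq_zero]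
    refine ge_of_tendsto' (ENNReal.tendsto_inv_nat_nhds_zero.comp (tendsto_add_atTop_nat 2))
      fun n => ?_
    refine (measure_mono fun ω hω => ?_).trans (ENNReal.le_inv_iff_mul_le.2
      ((mul_comm _ _).trans_le (mul_measure_hit_ne_top_le hP hQ (n := n + 2) (by omega))))
    exact fun h => hω ⟨n, h⟩
  filter_upwards [h1, h2] with ω hω ⟨n, hn⟩
  exact hω n hn

end HTransform

lemma measure_XInf_eq_one_iff (μ : Measure PathSpace) [IsProbabilityMeasure μ] (a : ℝ≥0∞) :
    μ {ω | XInf ω = a} = 1 ↔ ∀ᵐ ω ∂μ, XInf ω = a := by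
  rw [← prob_compl_eq_zero_iff
    (show MeasurableSet {ω | XInf ω = a} from measurable_XInf (measurableSet_singleton a))]
  rfl

end PathSpace

theorem corollary1 (P Q : Measure PathSpace) [IsProbabilityMeasure P]
    (hP : PathSpace.IsLocalMartingaleLaw P) (hQ : PathSpace.IsHTransform P Q) :
    (P {ω | PathSpace.XInf ω = 0} = 1 ↔ Q {ω | PathSpace.XInf ω = ∞} = 1) ∧
      (P {ω | PathSpace.XInf ω = 0} = 1 → P ⟂ₘ Q) := by
  have := hQ.isProbabilityMeasure
  rw [PathSpace.measure_XInf_eq_one_iff, PathSpace.measure_XInf_eq_one_iff]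
  refine ⟨⟨PathSpace.hTransform_ae_XInf_eq_top hP hQ,
    PathSpace.ae_XInf_eq_zero_of_hTransform hP hQ⟩, fun h => ?_⟩
  -- This set is P-null, and its complement {X_∞ = 0} is Q-null since X_∞ = ∞ Q-a.s.
  refine ⟨{ω | PathSpace.XInf ω ≠ 0},
    PathSpace.measurable_XInf (measurableSet_singleton 0).compl, h, ?_⟩
  refine measure_mono_null (fun ω hω => ?_) (PathSpace.hTransform_ae_XInf_eq_top hP hQ h)
  rw [Set.mem_compl_iff, Set.mem_ofPred_eq, not_not] at hω
  simp [hω]
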